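/- For $A\subseteq\omega$, say that $A$ has density $1$ if $\lim_n |A\cap\{0,\dots,n-1\}|/n=1$. A generic description of $g:\omega\to\omega$ is a partial function $d:\omega\to\omega$ whose domain has density $1$ and which satisfies $d(n)=g(n)$ whenever $d(n)$ is defined. The function $g$ is generically computable (respectively, generically computable relative to $X\in 2^\omega$) if it has a generic description that is partial computable (respectively, partial $X$-computable). Sets are identified with their characteristic functions, and $\mu$ is Lebesgue (fair coin) measure on $2^\omega$. For $n\ge 1$, a set $X$ is weakly $n$-random relative to $f$ if it belongs to every $\Sigma^{0,f}_n$ class $\mathcal C\subseteq 2^\omega$ with $\mu(\mathcal C)=1$. An enumeration operator is a c.e. set $W$ of pairs $(F,k)$ with $F\subset\omega$ finite, and $W^Y=\{k:(\exists (F,k)\in W)\ F\subseteq Y\}$. A partial function $e$ is enumeration reducible to a partial function $d$ if $W^{\mathrm{graph}(d)}=\mathrm{graph}(e)$ for some enumeration operator $W$. We say that $f$ is nonuniformly generically reducible to $g$ if for every generic description $d$ of $g$ there is a generic description $e$ of $f$ that is enumeration reducible to $d$; and that $f$ is uniformly generically reducible to $g$ if there is one enumeration operator $W$ such that, for every generic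 description $d$ of $g$, $W^{\mathrm{graph}(d)}$ is the graph of a generic description of $f$. Theorem. (1) If $f:\omega\to\omega$ is not generically computable, then $$\mu(\{X\in 2^\omega : f \text{ is generically computable relative to } X\})=0,$$ and no element of this class is weakly $4$-random relative to $f$. (2) All nontrivial upper cones in the uniform generic degrees of sets, and in the nonuniform generic degrees of sets, have measure $0$. That is, for each of the two reducibilities $\le$ and every set $A$ whose degree is not the least one (i.e. such that $A\not\le B$ for some set $B$), $\mu(\{X\in 2^\omega : A\le X\})=0$. -/

import Mathlib

/-! ### Asymptotic density -/

/-- `A ⊆ ω` has asymptotic density `r`: the proportions `|A ∩ {0, …, n - 1}| / n` converge to `r`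
(equivalently, the upper and the lower density of `A` are both `r`). -/
def HasAsymptoticDensity (A : Set ℕ) (r : ℝ) : Prop :=
  Filter.Tendsto (fun n : ℕ => ((A ∩ Set.Iio n).ncard : ℝ) / (n : ℝ)) Filter.atTop (nhds r)

/-! ### Generic computability -/

/-- The partial function `d` is a generic description of `g`: it agrees with `g` wherever it is
defined, and its domain has density `1`. -/
def IsGenericDescription (d : ℕ →. ℕ) (g : ℕ → ℕ) : Prop :=
  (∀ n, ∀ v ∈ d n, v = g n) ∧ HasAsymptoticDensity {n | (d n).Dom} 1

/-- `g` is generically computable: it has a partial computable generic description. -/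
def GenericallyComputable (g : ℕ → ℕ) : Prop :=
  ∃ d : ℕ →. ℕ, Nat.Partrec d ∧ IsGenericDescription d g

/-- The characteristic function of `X ∈ 2^ω`. -/
def charFun01 (X : ℕ → Bool) : ℕ → ℕ := fun n => (X n).toNat

/-- The oracle given by a total function. -/
def oracleOf (f : ℕ → ℕ) : Set (ℕ →. ℕ) := {(f : ℕ →. ℕ)}

/-- `g` is generically computable relative to `X`: it has a generic description that is partial
computable with oracle `X`. -/
def GenericallyComputableRel (g : ℕ → ℕ) (X : ℕ → Bool) : Prop :=
  ∃ d : ℕ →. ℕ, Nat.RecursiveIn (oracleOf (charFun01 X)) d ∧ IsGenericDescription d g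

/-! ### Lebesgue measure on Cantor space -/

/-- Lebesgue (fair coin) measure on `2^ω`. -/
noncomputable def cantorMeasure : MeasureTheory.Measure (ℕ → Bool) :=
  MeasureTheory.Measure.infinitePi fun _ : ℕ => (PMF.uniformOfFintype Bool).toMeasure

/-! ### The relativized arithmetical hierarchy of classes, and weak randomness -/

/-- `U` is computably enumerable relative to `f`: it is the domain of a partial function that is
computable with oracle `f`. -/
def CEIn (f : ℕ → ℕ) {α : Type} [Primcodable α] (U : Set α) : Prop :=
  ∃ φ : α →. ℕ, RecursiveIn (oracleOf f) φ ∧ ∀ a, a ∈ U ↔ (φ a).Dom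

/-- `C 0, C 1, …` is a uniform sequence of `Σ^{0,f}_n` classes in `2^ω` (for `n ≥ 1`).
For `n = 1`: there is an `f`-c.e. set `U` such that `X ∈ C k` iff `(k, σ) ∈ U` for some
initial segment `σ` of `X`. For `n + 1`: `C k` is the union over `m` of the complements of the
members `D ⟨k, m⟩` of a uniform sequence of `Σ^{0,f}_n` classes. -/
def UniformlySigma (f : ℕ → ℕ) : ℕ → (ℕ → Set (ℕ → Bool)) → Prop
  | 0, _ => False
  | 1, C => ∃ U : Set (ℕ × List Bool), CEIn f U ∧
      ∀ k, C k = {X | ∃ l : ℕ, (k, (List.range l).map X) ∈ U}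
  | n + 2, C => ∃ D : ℕ → Set (ℕ → Bool), UniformlySigma f (n + 1) D ∧
      ∀ k, C k = ⋃ m : ℕ, (D (Nat.pair k m))ᶜ

/-- `C ⊆ 2^ω` is a `Σ^{0,f}_n` class (`n ≥ 1`). -/
def IsSigmaClass (n : ℕ) (f : ℕ → ℕ) (C : Set (ℕ → Bool)) : Prop :=
  UniformlySigma f n fun _ => C

/-- `X` is weakly `n`-random relative to `f` (`n ≥ 1`): `X` belongs to every `Σ^{0,f}_n` class of
measure `1` (equivalently, `X` belongs to no `Π^{0,f}_n` class of measure `0`). -/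
def WeaklyRandomRel (n : ℕ) (f : ℕ → ℕ) (X : ℕ → Bool) : Prop :=
  ∀ C : Set (ℕ → Bool), IsSigmaClass n f C → cantorMeasure C = 1 → X ∈ C

/-! ### Enumeration operators and generic reducibility -/

/-- An enumeration operator is a c.e. set of pairs `(F, k)` with `F` finite; here the finite set
`F` is given by a list of its elements. -/
def IsEnumerationOperator (W : Set (List ℕ × ℕ)) : Prop :=
  REPred fun p : List ℕ × ℕ => p ∈ W

/-- `W^Y = {k | ∃ F, (F, k) ∈ W and F ⊆ Y}`. -/
def enumApply (W : Set (List ℕ × ℕ)) (Y : Set ℕ) : Set ℕ :=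
  {k | ∃ F : List ℕ, (F, k) ∈ W ∧ ∀ x ∈ F, x ∈ Y}

/-- The graph of a partial function, as a set of (codes of) pairs. -/
def pfunGraph (d : ℕ →. ℕ) : Set ℕ :=
  {p | ∃ n v : ℕ, v ∈ d n ∧ p = Nat.pair n v}

/-- `e` is enumeration reducible to `d`. -/
def EnumReducible (e d : ℕ →. ℕ) : Prop :=
  ∃ W : Set (List ℕ × ℕ), IsEnumerationOperator W ∧ enumApply W (pfunGraph d) = pfunGraph e

/-- `f` is nonuniformly generically reducible to `g`: every generic description of `g`
enumerates some generic description of `f`. -/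
def NonuniformGenericReducible (f g : ℕ → ℕ) : Prop :=
  ∀ d : ℕ →. ℕ, IsGenericDescription d g →
    ∃ e : ℕ →. ℕ, IsGenericDescription e f ∧ EnumReducible e d

/-- `f` is uniformly generically reducible to `g`: a single enumeration operator takes every
generic description of `g` to a generic description of `f`. -/
def UniformGenericReducible (f g : ℕ → ℕ) : Prop :=
  ∃ W : Set (List ℕ × ℕ), IsEnumerationOperator W ∧
    ∀ d : ℕ →. ℕ, IsGenericDescription d g →
      ∃ e : ℕ →. ℕ, enumApply W (pfunGraph d) = pfunGraph e ∧ IsGenericDescription e f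

/-- The upper cone, among sets, of the uniform generic degree of the set `A`. -/
def uniformGenericUpperCone (A : ℕ → Bool) : Set (ℕ → Bool) :=
  {X | UniformGenericReducible (charFun01 A) (charFun01 X)}

/-- The upper cone, among sets, of the nonuniform generic degree of the set `A`. -/
def nonuniformGenericUpperCone (A : ℕ → Bool) : Set (ℕ → Bool) :=
  {X | NonuniformGenericReducible (charFun01 A) (charFun01 X)}

/-! Computations from `X` and generic reductions to `X` both yield enumeration operators that,
applied to the graph of `X`, list the graph of a generic description of `f`. There are countably
many operators, so it is enough to treat one operator `V` and the class `S` of all `X` from which it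
succeeds (`describingClass`).

Suppose `S` has positive measure. Some clopen class `K` satisfies `μ(K \ S) < μ(K)/4`. Let `K` vote:
put `d(n) = v` once more than half of `K` has enumerated `(n, v)`. A wrong pair gets votes only from
`K \ S`, so `d` never errs. Where `d(n)` is undefined, at most half of `K` enumerates `(n, f n)`, so
at least a quarter of `K` lies in `S` and omits that pair. Each `X ∈ S` omits `(n, f n)` only for a
density-`0` set of `n`; averaging over `X` by dominated convergence
(`hasAsymptoticDensity_zero_of_forall`), the bad `n` have density `0`. So `f` is generically
computable (`cantorMeasure_describingClass`).

For weak randomness, membership in `S` has the form `∀ m ∃ N ∀ j ∃ l` over an `f`-computable matrix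
(`mem_describingClass_iff`), so the complement of `S` is a `Σ⁰₄` class relative to `f`, of measure
`1`, that omits every element of `S`.

For cones, `X` is a generic description of itself, so both upper cones of `A` lie in the union of
the describing classes; and if `A` is generically computable, both cones are everything. -/

/-! ### Oracle computations as enumeration operators -/

/-- `φ` computes `d` from finite parts of the graph of `g`: it never gives a wrong value, and each
value of `d` is found from all sufficiently large finite parts. -/
def FinitelyApproximates (φ : List ℕ × ℕ →. ℕ) (g : ℕ → ℕ) (d : ℕ →. ℕ) : Prop :=
  (∀ F n v, (∀ x ∈ F, x ∈ pfunGraph g) → v ∈ φ (F, n) → v ∈ d n) ∧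
  ∀ n v, v ∈ d n → ∃ F₀ : List ℕ, (∀ x ∈ F₀, x ∈ pfunGraph g) ∧
    ∀ F, F₀ ⊆ F → (∀ x ∈ F, x ∈ pfunGraph g) → v ∈ φ (F, n)

theorem pair_mem_pfunGraph {d : ℕ →. ℕ} {n v : ℕ} : Nat.pair n v ∈ pfunGraph d ↔ v ∈ d n := by
  constructor
  · rintro ⟨n', v', h, e⟩
    obtain ⟨rfl, rfl⟩ := Nat.pair_eq_pair.1 e
    exact h
  · exact fun h => ⟨n, v, h, rfl⟩

theorem pair_mem_pfunGraph_coe {g : ℕ → ℕ} {n v : ℕ} :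
    Nat.pair n v ∈ pfunGraph g ↔ v = g n := by
  rw [pair_mem_pfunGraph]; simp

theorem exists_finitelyApproximates_of_total (g : ℕ → ℕ) {h : ℕ → ℕ} (hh : Nat.Partrec h) :
    ∃ φ, Partrec φ ∧ FinitelyApproximates φ g h :=
  ⟨fun p => (h : ℕ →. ℕ) p.2, (Partrec.nat_iff.2 hh).comp Computable.snd,
    fun _ _ _ _ h => h, fun _ _ h => ⟨[], by simp, fun _ _ _ => h⟩⟩

/-- The query `n` is answered by the least `v` with the code of `(n, v)` in the finite part; since
`g` is single-valued, that is `g n` as soon as this one pair is present. -/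
theorem exists_finitelyApproximates_self (g : ℕ → ℕ) :
    ∃ φ, Partrec φ ∧ FinitelyApproximates φ g g := by
  have hp : PrimrecRel fun (p : List ℕ × ℕ) (v : ℕ) => ∃ x ∈ p.1, x = Nat.pair p.2 v :=
    (PrimrecRel.exists_mem_list Primrec.eq).comp (Primrec.fst.comp Primrec.fst)
      (Primrec₂.natPair.comp (Primrec.snd.comp Primrec.fst) Primrec.snd)
  have key : ∀ (p : List ℕ × ℕ) (v : ℕ),
      v ∈ Nat.rfind (fun v => Part.some (decide (∃ x ∈ p.1, x = Nat.pair p.2 v))) ↔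
        Nat.pair p.2 v ∈ p.1 ∧ ∀ w < v, Nat.pair p.2 w ∉ p.1 := by
    intro p v
    refine Nat.mem_rfind.trans ?_
    simp
  refine ⟨fun p => Nat.rfind fun v => Part.some (decide (∃ x ∈ p.1, x = Nat.pair p.2 v)),
    Partrec.rfind hp.decide.to_comp, ?_, ?_⟩
  · intro F n v hF hv
    have := hF _ ((key _ _).1 hv).1
    exact pair_mem_pfunGraph.1 this
  · intro n v hv
    refine ⟨[Nat.pair n v], by simpa [pair_mem_pfunGraph] using hv, fun F hs hF => ?_⟩
    refine (key _ _).2 ⟨hs (by simp), fun w hw hm => ?_⟩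
    have h1 := pair_mem_pfunGraph_coe.1 (hF _ hm)
    have h2 := pair_mem_pfunGraph_coe.1 (pair_mem_pfunGraph.2 hv)
    exact absurd (h1.trans h2.symm) hw.ne

/-- The finite parts needed by the two subcomputations are concatenated. Success is demanded on
every larger part of the graph precisely so that this works; the other closure lemmas do the same.
-/
theorem FinitelyApproximates.pair {g : ℕ → ℕ} {φ ψ : List ℕ × ℕ →. ℕ} {d e : ℕ →. ℕ}
    (hφ : FinitelyApproximates φ g d) (hψ : FinitelyApproximates ψ g e) :
    FinitelyApproximates (fun p => Nat.pair <$> φ p <*> ψ p) g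
      (fun n => Nat.pair <$> d n <*> e n) := by
  refine ⟨fun F n v hF hv => ?_, fun n v hv => ?_⟩
  · simp only [Seq.seq, Part.map_eq_map, Part.mem_bind_iff, Part.mem_map_iff,
      exists_exists_and_eq_and] at hv ⊢
    obtain ⟨a, ha, b, hb, rfl⟩ := hv
    exact ⟨a, hφ.1 F n a hF ha, b, hψ.1 F n b hF hb, rfl⟩
  · simp only [Seq.seq, Part.map_eq_map, Part.mem_bind_iff, Part.mem_map_iff,
      exists_exists_and_eq_and] at hv ⊢
    obtain ⟨a, ha, b, hb, rfl⟩ := hv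
    obtain ⟨F₁, h1, k1⟩ := hφ.2 n a ha
    obtain ⟨F₂, h2, k2⟩ := hψ.2 n b hb
    refine ⟨F₁ ++ F₂, fun x hx => (List.mem_append.1 hx).elim (h1 x) (h2 x), fun F hs hF => ?_⟩
    exact ⟨a, k1 F (fun x hx => hs (List.mem_append_left _ hx)) hF,
      b, k2 F (fun x hx => hs (List.mem_append_right _ hx)) hF, rfl⟩

theorem FinitelyApproximates.comp {g : ℕ → ℕ} {φ ψ : List ℕ × ℕ →. ℕ} {d e : ℕ →. ℕ}
    (hφ : FinitelyApproximates φ g d) (hψ : FinitelyApproximates ψ g e) :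
    FinitelyApproximates (fun p => (ψ p).bind fun m => φ (p.1, m)) g
      (fun n => e n >>= d) := by
  refine ⟨fun F n v hF hv => ?_, fun n v hv => ?_⟩
  · obtain ⟨m, hm, hv⟩ := Part.mem_bind_iff.1 hv
    exact Part.mem_bind_iff.2 ⟨m, hψ.1 F n m hF hm, hφ.1 F m v hF hv⟩
  · obtain ⟨m, hm, hv⟩ := Part.mem_bind_iff.1 hv
    obtain ⟨F₁, h1, k1⟩ := hψ.2 n m hm
    obtain ⟨F₂, h2, k2⟩ := hφ.2 m v hv
    refine ⟨F₁ ++ F₂, fun x hx => (List.mem_append.1 hx).elim (h1 x) (h2 x), fun F hs hF => ?_⟩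
    exact Part.mem_bind_iff.2 ⟨m, k1 F (fun x hx => hs (List.mem_append_left _ hx)) hF,
      k2 F (fun x hx => hs (List.mem_append_right _ hx)) hF⟩

theorem FinitelyApproximates.prec {g : ℕ → ℕ} {φ ψ : List ℕ × ℕ →. ℕ} {d e : ℕ →. ℕ}
    (hφ : FinitelyApproximates φ g d) (hψ : FinitelyApproximates ψ g e) :
    FinitelyApproximates
      (fun p => Nat.rec (φ (p.1, p.2.unpair.1))
        (fun y IH => IH.bind fun i => ψ (p.1, Nat.pair p.2.unpair.1 (Nat.pair y i))) p.2.unpair.2) g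
      (fun p => let (a, n) := Nat.unpair p
        n.rec (d a) fun y IH => do
          let i ← IH
          e (Nat.pair a (Nat.pair y i))) := by
  refine ⟨fun F p v hF hv => ?_, fun p v hv => ?_⟩
  · dsimp only at hv ⊢
    generalize p.unpair.2 = n at hv ⊢
    induction n generalizing v with
    | zero => exact hφ.1 F _ v hF hv
    | succ n ih =>
      obtain ⟨i, hi, hv⟩ := Part.mem_bind_iff.1 hv
      exact Part.mem_bind_iff.2 ⟨i, ih i hi, hψ.1 F _ v hF hv⟩
  · dsimp only at hv ⊢
    generalize p.unpair.2 = n at hv ⊢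
    induction n generalizing v with
    | zero => exact hφ.2 _ v hv
    | succ n ih =>
      obtain ⟨i, hi, hv⟩ := Part.mem_bind_iff.1 hv
      obtain ⟨F₁, h1, k1⟩ := ih i hi
      obtain ⟨F₂, h2, k2⟩ := hψ.2 _ v hv
      refine ⟨F₁ ++ F₂, fun x hx => (List.mem_append.1 hx).elim (h1 x) (h2 x), fun F hs hF => ?_⟩
      exact Part.mem_bind_iff.2 ⟨i, k1 F (fun x hx => hs (List.mem_append_left _ hx)) hF,
        k2 F (fun x hx => hs (List.mem_append_right _ hx)) hF⟩

theorem FinitelyApproximates.rfind {g : ℕ → ℕ} {φ : List ℕ × ℕ →. ℕ} {d : ℕ →. ℕ}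
    (hφ : FinitelyApproximates φ g d) :
    FinitelyApproximates
      (fun p => Nat.rfind fun n => (fun m => decide (m = 0)) <$> φ (p.1, Nat.pair p.2 n)) g
      (fun a => Nat.rfind fun n => (fun m => decide (m = 0)) <$> d (Nat.pair a n)) := by
  refine ⟨fun F a n hF hn => ?_, fun a n hn => ?_⟩
  · replace hn := Nat.mem_rfind.1 hn
    refine Nat.mem_rfind.2 ?_
    have aux : ∀ b m, b ∈ (fun m => decide (m = 0)) <$> φ (F, Nat.pair a m) →
        b ∈ (fun m => decide (m = 0)) <$> d (Nat.pair a m) := by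
      intro b m hb
      obtain ⟨x, hx, rfl⟩ := (Part.mem_map_iff _).1 hb
      exact (Part.mem_map_iff _).2 ⟨x, hφ.1 F _ x hF hx, rfl⟩
    exact ⟨aux _ _ hn.1, fun {m} hm => aux _ _ (hn.2 hm)⟩
  · replace hn := Nat.mem_rfind.1 hn
    have aux : ∀ b m, b ∈ (fun m => decide (m = 0)) <$> d (Nat.pair a m) →
        ∃ F₀ : List ℕ, (∀ x ∈ F₀, x ∈ pfunGraph g) ∧ ∀ F, F₀ ⊆ F → (∀ x ∈ F, x ∈ pfunGraph g) →
          b ∈ (fun m => decide (m = 0)) <$> φ (F, Nat.pair a m) := by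
      intro b m hb
      obtain ⟨x, hx, rfl⟩ := (Part.mem_map_iff _).1 hb
      obtain ⟨F₀, h1, k1⟩ := hφ.2 _ x hx
      exact ⟨F₀, h1, fun F hs hF => (Part.mem_map_iff _).2 ⟨x, k1 F hs hF, rfl⟩⟩
    -- The tests up to `n` must come out as `decide (m = n)`. Only finitely many matter, so for `m >
    -- n` the empty part is a dummy value.
    have all : ∀ m, ∃ F₀ : List ℕ, (∀ x ∈ F₀, x ∈ pfunGraph g) ∧ (m ≤ n → ∀ F, F₀ ⊆ F →
        (∀ x ∈ F, x ∈ pfunGraph g) →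
          decide (m = n) ∈ (fun m => decide (m = 0)) <$> φ (F, Nat.pair a m)) := by
      intro m
      rcases lt_trichotomy m n with h | rfl | h
      · obtain ⟨F₀, h1, k1⟩ := aux _ _ (hn.2 h)
        exact ⟨F₀, h1, fun _ => by simpa [h.ne] using k1⟩
      · obtain ⟨F₀, h1, k1⟩ := aux _ _ hn.1
        exact ⟨F₀, h1, fun _ => by simpa using k1⟩
      · exact ⟨[], by simp, fun h' => absurd h' (by omega)⟩
    choose G hG kG using all
    refine ⟨(List.range (n + 1)).flatMap G, fun x hx => ?_, fun F hs hF => ?_⟩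
    · obtain ⟨m, -, hm⟩ := List.mem_flatMap.1 hx
      exact hG m x hm
    · have use : ∀ m ≤ n, decide (m = n) ∈ (fun m => decide (m = 0)) <$> φ (F, Nat.pair a m) :=
        fun m hm => kG m hm F (fun x hx => hs (List.mem_flatMap.2 ⟨m, by simp; omega, hx⟩)) hF
      refine Nat.mem_rfind.2 ⟨by simpa using use n le_rfl, fun {m} hm => ?_⟩
      simpa [hm.ne] using use m hm.le

theorem exists_finitelyApproximates (g : ℕ → ℕ) {d : ℕ →. ℕ}
    (hd : Nat.RecursiveIn (oracleOf g) d) : ∃ φ, Partrec φ ∧ FinitelyApproximates φ g d := by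
  induction hd with
  | zero => exact exists_finitelyApproximates_of_total g (h := fun _ => 0) Nat.Partrec.zero
  | succ => exact exists_finitelyApproximates_of_total g Nat.Partrec.succ
  | left => exact exists_finitelyApproximates_of_total g (h := fun n => n.unpair.1) Nat.Partrec.left
  | right =>
    exact exists_finitelyApproximates_of_total g (h := fun n => n.unpair.2) Nat.Partrec.right
  | oracle h hh =>
    obtain rfl : h = (g : ℕ →. ℕ) := hh
    exact exists_finitelyApproximates_self g
  | pair _ _ ihf ihh =>
    obtain ⟨φ, pφ, hφ⟩ := ihf
    obtain ⟨ψ, pψ, hψ⟩ := ihh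
    refine ⟨_, ?_, hφ.pair hψ⟩
    refine Partrec.of_eq (pφ.bind (g := fun p a => (ψ p).map (Nat.pair a))
      (Partrec.map (pψ.comp Computable.fst)
        (Primrec₂.natPair.to_comp.comp (Computable.snd.comp Computable.fst) Computable.snd))) ?_
    intro p
    simp [Seq.seq, Part.map_eq_map, Part.bind_map]
  | comp _ _ ihf ihh =>
    obtain ⟨φ, pφ, hφ⟩ := ihf
    obtain ⟨ψ, pψ, hψ⟩ := ihh
    exact ⟨_, pψ.bind (g := fun p m => φ (p.1, m)) (pφ.comp ((Computable.fst.comp Computable.fst).pair Computable.snd)),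
      hφ.comp hψ⟩
  | prec _ _ ihf ihh =>
    obtain ⟨φ, pφ, hφ⟩ := ihf
    obtain ⟨ψ, pψ, hψ⟩ := ihh
    refine ⟨_, ?_, hφ.prec hψ⟩
    have h1 : Computable fun p : List ℕ × ℕ => p.2.unpair.1 :=
      Computable.fst.comp (Computable.unpair.comp Computable.snd)
    have h2 : Computable fun p : List ℕ × ℕ => p.2.unpair.2 :=
      Computable.snd.comp (Computable.unpair.comp Computable.snd)
    refine Partrec.nat_rec (h := fun p q => ψ (p.1, Nat.pair p.2.unpair.1 (Nat.pair q.1 q.2)))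
      h2 (pφ.comp (Computable.fst.pair h1)) (pψ.comp ?_)
    exact (Computable.fst.comp Computable.fst).pair
      (Primrec₂.natPair.to_comp.comp (h1.comp Computable.fst)
        (Primrec₂.natPair.to_comp.comp (Computable.fst.comp Computable.snd)
          (Computable.snd.comp Computable.snd)))
  | rfind _ ihf =>
    obtain ⟨φ, pφ, hφ⟩ := ihf
    refine ⟨_, ?_, hφ.rfind⟩
    have h0 : Computable fun m : ℕ => decide (m = 0) :=
      (Primrec.eq.comp Primrec.id (Primrec.const 0)).decide.to_comp
    refine Partrec.rfind (Partrec.map (pφ.comp ?_) (h0.comp Computable.snd))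
    exact (Computable.fst.comp Computable.fst).pair
      (Primrec₂.natPair.to_comp.comp (Computable.snd.comp Computable.fst) Computable.snd)

/-- After computing `φ` one searches with a constant test: it stops at once if the value is the
given one and diverges otherwise. -/
theorem Partrec.rePred_mem {α : Type*} [Primcodable α] {φ : α →. ℕ} (h : Partrec φ) :
    REPred fun p : α × ℕ => p.2 ∈ φ p.1 := by
  have h' : Partrec fun p : α × ℕ => (φ p.1).bind fun v =>
      Nat.rfind fun _ => Part.some (decide (v = p.2)) := by
    refine (h.comp Computable.fst).bind (Partrec.rfind (Computable.partrec ?_))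
    exact (Primrec.eq.comp (Primrec.snd.comp Primrec.fst)
      (Primrec.snd.comp (Primrec.fst.comp Primrec.fst))).decide.to_comp
  refine h'.dom_re.of_eq fun p => ?_
  rw [Part.dom_iff_mem]
  constructor
  · rintro ⟨y, hy⟩
    obtain ⟨v, hv, hy⟩ := Part.mem_bind_iff.1 hy
    have := (Nat.mem_rfind.1 hy).1
    simp only [Part.mem_some_iff, eq_comm (a := true), decide_eq_true_eq] at this
    exact this ▸ hv
  · intro hv
    exact ⟨0, Part.mem_bind_iff.2 ⟨_, hv, Nat.mem_rfind.2 (by simp)⟩⟩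

/-- A partial function computable with the oracle `g` is enumeration reducible to `g`. -/
theorem enumReducible_of_recursiveIn {g : ℕ → ℕ} {d : ℕ →. ℕ}
    (hd : Nat.RecursiveIn (oracleOf g) d) : EnumReducible d g := by
  obtain ⟨φ, pφ, h1, h2⟩ := exists_finitelyApproximates g hd
  refine ⟨{p | p.2.unpair.2 ∈ φ (p.1, p.2.unpair.1)}, ?_, ?_⟩
  · have hc : Computable fun p : List ℕ × ℕ => ((p.1, p.2.unpair.1), p.2.unpair.2) :=
      (Computable.fst.pair (Computable.fst.comp (Computable.unpair.comp Computable.snd))).pair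
        (Computable.snd.comp (Computable.unpair.comp Computable.snd))
    exact Partrec.comp pφ.rePred_mem hc
  · ext k
    obtain ⟨n, v, rfl⟩ : ∃ n v, k = Nat.pair n v := ⟨_, _, (Nat.pair_unpair k).symm⟩
    rw [pair_mem_pfunGraph]
    constructor
    · rintro ⟨F, hF, hg⟩
      exact h1 F n v hg (by simpa using hF)
    · intro hv
      obtain ⟨F, hF, k⟩ := h2 n v hv
      exact ⟨F, by simpa using k F (List.Subset.refl F) hF, hF⟩

/-! ### Enumeration from initial segments, and describing classes -/

/-- The initial segment of length `l` of `X`. -/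
def initSeg (X : ℕ → Bool) (l : ℕ) : List Bool := (List.range l).map X

theorem initSeg_length (X : ℕ → Bool) (l : ℕ) : (initSeg X l).length = l := by simp [initSeg]

theorem initSeg_getElem? (X : ℕ → Bool) (l i : ℕ) :
    (initSeg X l)[i]? = if i < l then some (X i) else none := by
  by_cases h : i < l <;> simp [initSeg, h]

theorem initSeg_eq_iff (X Y : ℕ → Bool) (l : ℕ) :
    initSeg X l = initSeg Y l ↔ ∀ i < l, X i = Y i := by
  simp [initSeg]

/-- `V` is monotone along the initial segments of every `X`. -/
def MonotoneRel (V : List Bool → ℕ → Prop) : Prop :=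
  ∀ (X : ℕ → Bool) (l l' p : ℕ), l ≤ l' → V (initSeg X l) p → V (initSeg X l') p

/-- The set enumerated by `V` from `X`. -/
def enumerated (V : List Bool → ℕ → Prop) (X : ℕ → Bool) : Set ℕ :=
  {p | ∃ l, V (initSeg X l) p}

/-- The class of all `X` from which `V` enumerates the graph of a generic description of `f`. -/
def describingClass (V : List Bool → ℕ → Prop) (f : ℕ → ℕ) : Set (ℕ → Bool) :=
  {X | (∀ p ∈ enumerated V X, p.unpair.2 = f p.unpair.1) ∧
    HasAsymptoticDensity {n | Nat.pair n (f n) ∈ enumerated V X} 1}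

/-- `p` is enumerated by the operator with code `c` from the finite information `τ` in at most
`|τ|` steps. -/
def stageRel (c : Nat.Partrec.Code) (τ : List Bool) (p : ℕ) : Prop :=
  ∃ q < τ.length, (Nat.Partrec.Code.evaln τ.length c (Nat.pair q p)).isSome ∧
    ∀ x ∈ Denumerable.ofNat (List ℕ) q, τ[x.unpair.1]?.map Bool.toNat = some x.unpair.2

/-- The length of `τ` bounds both the code of the finite set and the running time, so every
quantifier is bounded. -/
theorem primrecRel_stageRel (c : Nat.Partrec.Code) : PrimrecRel (stageRel c) := by
  have hq : PrimrecRel fun (x : ℕ) (τ : List Bool) =>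
      τ[x.unpair.1]?.map Bool.toNat = some x.unpair.2 := by
    refine Primrec.eq.comp (Primrec.option_map (Primrec.list_getElem?.comp Primrec.snd
      (Primrec.fst.comp (Primrec.unpair.comp Primrec.fst)))
      ((Primrec.dom_finite Bool.toNat).comp Primrec.snd))
      (Primrec.option_some.comp (Primrec.snd.comp (Primrec.unpair.comp Primrec.fst)))
  have h1 : PrimrecRel fun (q : ℕ) (a : List Bool × ℕ) =>
      ∀ x ∈ Denumerable.ofNat (List ℕ) q, a.1[x.unpair.1]?.map Bool.toNat = some x.unpair.2 :=
    hq.forall_mem_list.comp ((Primrec.ofNat (List ℕ)).comp Primrec.fst)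
      (Primrec.fst.comp Primrec.snd)
  have h2 : PrimrecRel fun (q : ℕ) (a : List Bool × ℕ) =>
      (Nat.Partrec.Code.evaln a.1.length c (Nat.pair q a.2)).isSome = true := by
    refine Primrec.eq.comp (Primrec.option_isSome.comp (Nat.Partrec.Code.primrec_evaln.comp
      (Primrec.pair (Primrec.pair (Primrec.list_length.comp (Primrec.fst.comp Primrec.snd))
        (Primrec.const c)) (Primrec₂.natPair.comp Primrec.fst (Primrec.snd.comp Primrec.snd)))))
      (Primrec.const true)
  have h3 : PrimrecRel fun (q : ℕ) (a : List Bool × ℕ) =>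
      (Nat.Partrec.Code.evaln a.1.length c (Nat.pair q a.2)).isSome = true ∧
      ∀ x ∈ Denumerable.ofNat (List ℕ) q, a.1[x.unpair.1]?.map Bool.toNat = some x.unpair.2 :=
    h2.and h1
  refine (h3.exists_mem_list.comp (Primrec.list_range.comp (Primrec.list_length.comp Primrec.fst))
    Primrec.id).of_eq fun a => ?_
  simp [stageRel]

theorem monotoneRel_stageRel (c : Nat.Partrec.Code) : MonotoneRel (stageRel c) := by
  rintro X l l' p hl ⟨q, hq, hs, hx⟩
  simp only [initSeg_length] at hq hs
  refine ⟨q, by simpa [initSeg_length] using hq.trans_le hl, ?_, fun x hxq => ?_⟩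
  · obtain ⟨v, hv⟩ := Option.isSome_iff_exists.1 hs
    rw [initSeg_length]
    exact Option.isSome_iff_exists.2 ⟨v, Nat.Partrec.Code.evaln_mono hl hv⟩
  · have := hx x hxq
    rw [initSeg_getElem?] at this ⊢
    split_ifs at this with h
    · rw [if_pos (h.trans_le hl)]; exact this
    · simp at this

theorem mem_pfunGraph_charFun01 (X : ℕ → Bool) (x : ℕ) :
    x ∈ pfunGraph (charFun01 X) ↔ (X x.unpair.1).toNat = x.unpair.2 := by
  conv_lhs => rw [← Nat.pair_unpair x]
  rw [pair_mem_pfunGraph_coe]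
  exact eq_comm

theorem exists_code_enumApply {W : Set (List ℕ × ℕ)} (hW : IsEnumerationOperator W) :
    ∃ c, ∀ X : ℕ → Bool, enumApply W (pfunGraph (charFun01 X)) = enumerated (stageRel c) X := by
  obtain ⟨c, hc⟩ := Nat.Partrec.Code.exists_code.1 hW
  have hdom : ∀ q p, (Denumerable.ofNat (List ℕ) q, p) ∈ W ↔ (c.eval (Nat.pair q p)).Dom := by
    intro q p
    have : (Encodable.decode (Nat.pair q p) : Option (List ℕ × ℕ)) =
        some (Denumerable.ofNat (List ℕ) q, p) := by
      simp [Denumerable.decode_eq_ofNat]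
    rw [hc]
    dsimp only
    rw [this]
    simp [Part.assert]
  refine ⟨c, fun X => Set.ext fun p => ⟨?_, ?_⟩⟩
  · rintro ⟨F, hF, hX⟩
    obtain ⟨q, rfl⟩ : ∃ q, F = Denumerable.ofNat (List ℕ) q := ⟨Encodable.encode F, by simp⟩
    obtain ⟨v, hv⟩ := Part.dom_iff_mem.1 ((hdom q p).1 hF)
    obtain ⟨k, hk⟩ := Nat.Partrec.Code.evaln_complete.1 hv
    -- `B` exceeds every position of `X` that the finite set mentions; the segment chosen below is
    -- also longer than the running time `k` and the code `q`.
    set B := ((Denumerable.ofNat (List ℕ) q).map fun x => x.unpair.1 + 1).sum with hB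
    refine ⟨k + q + 1 + B, q, by rw [initSeg_length]; omega, ?_, fun x hx => ?_⟩
    · rw [initSeg_length]
      exact Option.isSome_iff_exists.2 ⟨v, Nat.Partrec.Code.evaln_mono (by omega) hk⟩
    · have hle : x.unpair.1 + 1 ≤ B := List.le_sum_of_mem (List.mem_map.2 ⟨x, hx, rfl⟩)
      rw [initSeg_getElem?, if_pos (by omega)]
      simpa using (mem_pfunGraph_charFun01 X x).1 (hX x hx)
  · rintro ⟨l, q, -, hs, hx⟩
    obtain ⟨v, hv⟩ := Option.isSome_iff_exists.1 hs
    refine ⟨_, (hdom q p).2 (Part.dom_iff_mem.2 ⟨v, Nat.Partrec.Code.evaln_sound hv⟩),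
      fun x hxq => (mem_pfunGraph_charFun01 X x).2 ?_⟩
    have := hx x hxq
    rw [initSeg_getElem?] at this
    split_ifs at this with h
    · simpa using this
    · simp at this

theorem mem_describingClass_of_enumApply {W : Set (List ℕ × ℕ)} {X : ℕ → Bool} {f : ℕ → ℕ}
    {e : ℕ →. ℕ} {V : List Bool → ℕ → Prop}
    (hV : enumApply W (pfunGraph (charFun01 X)) = enumerated V X)
    (he : enumApply W (pfunGraph (charFun01 X)) = pfunGraph e) (hef : IsGenericDescription e f) :
    X ∈ describingClass V f := by
  have hE : enumerated V X = pfunGraph e := hV.symm.trans he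
  refine ⟨fun p hp => ?_, ?_⟩
  · rw [hE] at hp
    obtain ⟨n, v, hv, rfl⟩ := hp
    simpa using hef.1 n v hv
  · have : {n | Nat.pair n (f n) ∈ enumerated V X} = {n | (e n).Dom} := by
      ext n
      rw [Set.mem_ofPred_eq, hE, pair_mem_pfunGraph, Set.mem_ofPred_eq, Part.dom_iff_mem]
      exact ⟨fun h => ⟨_, h⟩, fun ⟨v, hv⟩ => hef.1 n v hv ▸ hv⟩
    rw [this]
    exact hef.2

theorem IsGenericDescription.refl (g : ℕ → ℕ) : IsGenericDescription (g : ℕ →. ℕ) g := by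
  refine ⟨fun n v hv => by simpa using hv, ?_⟩
  have : {n | ((g : ℕ →. ℕ) n).Dom} = Set.univ := by ext n; simp
  rw [this, HasAsymptoticDensity]
  refine tendsto_const_nhds.congr' ?_
  filter_upwards [Filter.eventually_gt_atTop 0] with n hn
  rw [Set.univ_inter, ← Nat.card_coe_set_eq]
  simp [hn.ne']

theorem genericallyComputableRel_subset (f : ℕ → ℕ) :
    {X | GenericallyComputableRel f X} ⊆ ⋃ c, describingClass (stageRel c) f := by
  rintro X ⟨d, hd, hdf⟩
  obtain ⟨W, hW, h⟩ := enumReducible_of_recursiveIn hd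
  obtain ⟨c, hc⟩ := exists_code_enumApply hW
  exact Set.mem_iUnion.2 ⟨c, mem_describingClass_of_enumApply (hc X) h hdf⟩

theorem uniformGenericUpperCone_subset (A : ℕ → Bool) :
    uniformGenericUpperCone A ⊆ nonuniformGenericUpperCone A := by
  rintro X ⟨W, hW, h⟩ d hd
  obtain ⟨e, he, hef⟩ := h d hd
  exact ⟨e, hef, W, hW, he⟩

/-- Of all generic descriptions of `X`, only the total one, `X` itself, is needed. -/
theorem nonuniformGenericUpperCone_subset (A : ℕ → Bool) :
    nonuniformGenericUpperCone A ⊆ ⋃ c, describingClass (stageRel c) (charFun01 A) := by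
  intro X h
  obtain ⟨e, hef, W, hW, he⟩ := h _ (IsGenericDescription.refl _)
  obtain ⟨c, hc⟩ := exists_code_enumApply hW
  exact Set.mem_iUnion.2 ⟨c, mem_describingClass_of_enumApply (hc X) he hef⟩

/-- An operator that ignores its input enumerates a fixed partial computable description of `A`. -/
theorem uniformGenericUpperCone_eq_univ {A : ℕ → Bool} (h : GenericallyComputable (charFun01 A)) :
    uniformGenericUpperCone A = Set.univ := by
  obtain ⟨e, pe, he⟩ := h
  refine Set.eq_univ_of_forall fun X => ⟨{p | p.2.unpair.2 ∈ e p.2.unpair.1}, ?_, fun d _ =>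
    ⟨e, ?_, he⟩⟩
  · exact Partrec.comp (Partrec.nat_iff.2 pe).rePred_mem (Computable.unpair.comp Computable.snd)
  · ext k
    obtain ⟨n, v, rfl⟩ : ∃ n v, k = Nat.pair n v := ⟨_, _, (Nat.pair_unpair k).symm⟩
    rw [pair_mem_pfunGraph]
    exact ⟨fun ⟨F, hF, _⟩ => by simpa using hF, fun hv => ⟨[], by simpa using hv, by simp⟩⟩

/-! ### Asymptotic density -/

open Filter in
theorem hasAsymptoticDensity_compl {A : Set ℕ} :
    HasAsymptoticDensity A 1 ↔ HasAsymptoticDensity Aᶜ 0 := by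
  have key : ∀ n : ℕ, 0 < n →
      ((Aᶜ ∩ Set.Iio n).ncard : ℝ) / n = 1 - ((A ∩ Set.Iio n).ncard : ℝ) / n := by
    intro n hn
    have h1 : (A ∩ Set.Iio n).ncard + (Aᶜ ∩ Set.Iio n).ncard = n := by
      rw [Set.inter_comm A, Set.inter_comm Aᶜ, ← Set.sdiff_eq,
        Set.ncard_inter_add_ncard_sdiff_eq_ncard _ _ (Set.finite_Iio n), ← Nat.card_coe_set_eq]
      simp
    have h2 : ((A ∩ Set.Iio n).ncard : ℝ) + ((Aᶜ ∩ Set.Iio n).ncard : ℝ) = n := by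
      exact_mod_cast h1
    have h3 : (n : ℝ) ≠ 0 := by positivity
    field_simp
    linarith
  have ev : (fun n : ℕ => ((Aᶜ ∩ Set.Iio n).ncard : ℝ) / n) =ᶠ[atTop]
      fun n => 1 - ((A ∩ Set.Iio n).ncard : ℝ) / n := by
    filter_upwards [eventually_gt_atTop 0] with n hn using key n hn
  unfold HasAsymptoticDensity
  rw [tendsto_congr' ev]
  constructor
  · intro h; simpa using h.const_sub 1
  · intro h; simpa using h.const_sub 1

theorem HasAsymptoticDensity.mono_zero {A B : Set ℕ} (hA : HasAsymptoticDensity A 0)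
    (h : B ⊆ A) : HasAsymptoticDensity B 0 := by
  refine squeeze_zero (fun n => by positivity) (fun n => ?_) hA
  have : (B ∩ Set.Iio n).ncard ≤ (A ∩ Set.Iio n).ncard :=
    Set.ncard_le_ncard (Set.inter_subset_inter_left _ h) ((Set.finite_Iio n).inter_of_right _)
  gcongr

theorem hasAsymptoticDensity_empty : HasAsymptoticDensity ∅ 0 := by
  simp [HasAsymptoticDensity]

theorem ncard_inter_Iio (A : Set ℕ) [DecidablePred (· ∈ A)] (n : ℕ) :
    (A ∩ Set.Iio n).ncard = ((Finset.range n).filter (· ∈ A)).card := by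
  rw [← Set.ncard_coe_finset]
  congr 1
  ext i
  simp [and_comm]

/-- A set has density `1` iff for every `m`, eventually at most the fraction `1 / (m + 1)` of the
numbers below `j` are outside of it. -/
theorem hasAsymptoticDensity_one_iff {A : Set ℕ} [DecidablePred (· ∈ A)] :
    HasAsymptoticDensity A 1 ↔ ∀ m : ℕ, ∃ N : ℕ, ∀ j, N ≤ j →
      (m + 1) * ((Finset.range j).filter (· ∉ A)).card ≤ j := by
  rw [hasAsymptoticDensity_compl]
  have hc : ∀ j, (Aᶜ ∩ Set.Iio j).ncard = ((Finset.range j).filter (· ∉ A)).card := by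
    intro j
    rw [ncard_inter_Iio]
    simp
  constructor
  · intro h m
    have h1 := h.eventually (gt_mem_nhds (show (0 : ℝ) < 1 / (m + 1) by positivity))
    obtain ⟨N, hN⟩ := Filter.eventually_atTop.1 h1
    refine ⟨N, fun j hj => ?_⟩
    have h2 := hN j hj
    rw [hc] at h2
    rcases Nat.eq_zero_or_pos j with rfl | hj0
    · simp
    · rw [div_lt_div_iff₀ (by positivity) (by positivity)] at h2
      have h3 : (((Finset.range j).filter (· ∉ A)).card * (m + 1) : ℕ) ≤ j := by
        have : ((((Finset.range j).filter (· ∉ A)).card * (m + 1) : ℕ) : ℝ) ≤ j := by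
          push_cast; linarith
        exact_mod_cast this
      linarith
  · intro h
    unfold HasAsymptoticDensity
    rw [Metric.tendsto_atTop]
    intro ε hε
    obtain ⟨m, hm⟩ := exists_nat_one_div_lt hε
    obtain ⟨N, hN⟩ := h m
    refine ⟨N + 1, fun j hj => ?_⟩
    have h1 := hN j (by omega)
    rw [hc, Real.dist_eq, sub_zero, abs_of_nonneg (by positivity)]
    refine lt_of_le_of_lt ?_ hm
    have hj0 : (0 : ℝ) < j := by exact_mod_cast (by omega : 0 < j)
    rw [div_le_div_iff₀ hj0 (by positivity)]
    have : (((m + 1) * ((Finset.range j).filter (· ∉ A)).card : ℕ) : ℝ) ≤ j := by exact_mod_cast h1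
    push_cast at this
    linarith

open MeasureTheory Filter in
/-- If for every `X` the set of `n` with `X ∈ H n` has density `0`, then so has the set of `n` for
which `H n` has measure at least `δ`. -/
theorem hasAsymptoticDensity_zero_of_forall {Ω : Type*} [MeasurableSpace Ω] (μ : Measure Ω)
    [IsFiniteMeasure μ] {H : ℕ → Set Ω} (hH : ∀ n, MeasurableSet (H n))
    (h0 : ∀ X, HasAsymptoticDensity {n | X ∈ H n} 0) {δ : ℝ} (hδ : 0 < δ) :
    HasAsymptoticDensity {n | δ ≤ μ.real (H n)} 0 := by
  classical
  -- `G N X` is the fraction of `n < N` with `X ∈ H n`. It is bounded by `1` and tends to `0`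
  -- pointwise, and its integral is the average of the measures of `H n`.
  set G : ℕ → Ω → ℝ := fun N X => (∑ n ∈ Finset.range N, (H n).indicator 1 X) / N with hG
  have hGeq : ∀ N X, G N X = (({n | X ∈ H n} ∩ Set.Iio N).ncard : ℝ) / N := by
    intro N X
    rw [ncard_inter_Iio]
    simp [hG, Set.indicator_apply]
  have hlim : Tendsto (fun N => ∫ X, G N X ∂μ) atTop (nhds 0) := by
    have := tendsto_integral_of_dominated_convergence (F := G) (f := fun _ => (0 : ℝ)) (μ := μ)
      (fun _ => (1 : ℝ)) (fun N => ?_) (integrable_const _) (fun N => ?_) ?_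
    · simpa using this
    · refine Measurable.aestronglyMeasurable ?_
      refine Measurable.div_const ?_ _
      exact Finset.measurable_sum _ fun n _ => measurable_one.indicator (hH n)
    · refine Eventually.of_forall fun X => ?_
      rw [hGeq, Real.norm_of_nonneg (by positivity), ncard_inter_Iio]
      refine div_le_one_of_le₀ ?_ (by positivity)
      exact_mod_cast (Finset.card_filter_le _ _).trans (by simp)
    · refine Eventually.of_forall fun X => ?_
      simp only [hGeq]
      exact h0 X
  have hint : ∀ N, ∫ X, G N X ∂μ = (∑ n ∈ Finset.range N, μ.real (H n)) / N := by
    intro N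
    simp only [hG]
    rw [integral_div, integral_finsetSum]
    · simp_rw [integral_indicator_one (hH _)]
    · intro n _
      exact (integrable_const (1 : ℝ)).indicator (hH n)
  have h1 : Tendsto (fun N => δ⁻¹ * ∫ X, G N X ∂μ) atTop (nhds 0) := by
    simpa using hlim.const_mul δ⁻¹
  -- Markov's inequality for counting measure below `N`.
  refine squeeze_zero (fun n => by positivity) (fun N => ?_) h1
  rw [hint, ncard_inter_Iio, ← mul_div_assoc]
  gcongr
  rw [← div_eq_inv_mul, le_div_iff₀ hδ]
  calc _ = ∑ n ∈ (Finset.range N).filter (· ∈ {n | δ ≤ μ.real (H n)}), δ := by simp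
    _ ≤ ∑ n ∈ (Finset.range N).filter (· ∈ {n | δ ≤ μ.real (H n)}), μ.real (H n) :=
      Finset.sum_le_sum fun n hn => (Finset.mem_filter.1 hn).2
    _ ≤ _ := Finset.sum_le_sum_of_subset_of_nonneg (Finset.filter_subset _ _)
      fun _ _ _ => measureReal_nonneg

/-! ### Measure of classes determined by initial segments -/

open MeasureTheory

instance : IsProbabilityMeasure cantorMeasure := by
  unfold cantorMeasure; infer_instance

theorem initSeg_eq_iff_mem_pi {τ : List Bool} {s : ℕ} (hτ : τ.length = s) (X : ℕ → Bool) :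
    initSeg X s = τ ↔ X ∈ Set.pi (Finset.range s : Set ℕ) fun i => {τ.getD i false} := by
  subst hτ
  simp only [Set.mem_pi, Finset.coe_range, Set.mem_Iio, Set.mem_singleton_iff]
  constructor
  · intro h i hi
    have := initSeg_getElem? X τ.length i
    rw [h, if_pos hi] at this
    simp [this]
  · intro h
    refine List.ext_getElem (initSeg_length _ _) fun i h1 h2 => ?_
    have := h i h2
    simp only [initSeg, List.getElem_map, List.getElem_range]
    simp [this, h2]

theorem measurableSet_initSeg_eq (s : ℕ) (τ : List Bool) :
    MeasurableSet {X | initSeg X s = τ} := by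
  by_cases hτ : τ.length = s
  · have : {X | initSeg X s = τ} = Set.pi (Finset.range s : Set ℕ) fun i => {τ.getD i false} :=
      Set.ext fun X => initSeg_eq_iff_mem_pi hτ X
    rw [this]
    exact MeasurableSet.pi (Finset.countable_toSet _) fun i _ => measurableSet_singleton _
  · have : {X | initSeg X s = τ} = ∅ := by
      ext X
      simp only [Set.mem_ofPred_eq, Set.mem_empty_iff_false, iff_false]
      rintro rfl
      exact hτ (initSeg_length X s)
    rw [this]
    exact MeasurableSet.empty

theorem measurableSet_initSeg (P : List Bool → Prop) (s : ℕ) :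
    MeasurableSet {X | P (initSeg X s)} := by
  have : {X | P (initSeg X s)} = ⋃ τ : {τ // P τ}, {X | initSeg X s = τ} := by
    ext X
    simp
  rw [this]
  exact MeasurableSet.iUnion fun τ => measurableSet_initSeg_eq s τ

theorem cantorMeasure_initSeg_eq {τ : List Bool} {s : ℕ} (hτ : τ.length = s) :
    cantorMeasure.real {X | initSeg X s = τ} = (1 / 2) ^ s := by
  have : {X | initSeg X s = τ} = Set.pi (Finset.range s : Set ℕ) fun i => {τ.getD i false} :=
    Set.ext fun X => initSeg_eq_iff_mem_pi hτ X
  rw [this, Measure.real, cantorMeasure, Measure.infinitePi_pi]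
  · simp
  · exact fun i _ => measurableSet_singleton _

/-- The list of all strings of length `s`. -/
def allStrings : ℕ → List (List Bool)
  | 0 => [[]]
  | s + 1 => (allStrings s).flatMap fun τ => [τ ++ [false], τ ++ [true]]

theorem mem_allStrings {s : ℕ} {τ : List Bool} : τ ∈ allStrings s ↔ τ.length = s := by
  induction s generalizing τ with
  | zero => simp [allStrings]
  | succ s ih =>
    simp only [allStrings, List.mem_flatMap, ih, List.mem_cons, List.not_mem_nil, or_false]
    constructor
    · rintro ⟨σ, rfl, rfl | rfl⟩ <;> simp
    · intro h
      rcases List.eq_nil_or_concat τ with rfl | ⟨σ, b, rfl⟩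
      · simp at h
      · refine ⟨σ, by simpa using h, ?_⟩
        cases b <;> simp

theorem nodup_allStrings (s : ℕ) : (allStrings s).Nodup := by
  induction s with
  | zero => simp [allStrings]
  | succ s ih =>
    rw [allStrings, List.nodup_flatMap]
    refine ⟨fun τ _ => by simp, ih.imp fun {σ τ} h => ?_⟩
    simp only [Function.onFun, List.disjoint_left]
    intro x hx hx'
    simp only [List.mem_cons, List.not_mem_nil, or_false] at hx hx'
    rcases hx with rfl | rfl <;> rcases hx' with h' | h' <;> simp_all

theorem primrec_allStrings : Primrec allStrings := by
  have h : Primrec₂ fun (τ : List Bool) (b : Bool) => τ ++ [b] :=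
    Primrec.list_concat
  have h1 : Primrec fun τ : List Bool => [τ ++ [false], τ ++ [true]] :=
    Primrec.list_cons.comp (h.comp Primrec.id (Primrec.const false))
      (Primrec.list_cons.comp (h.comp Primrec.id (Primrec.const true)) (Primrec.const []))
  have h2 : Primrec₂ fun (_ : ℕ) (L : List (List Bool)) =>
      L.flatMap fun τ => [τ ++ [false], τ ++ [true]] :=
    Primrec.list_flatMap Primrec.snd (h1.comp Primrec.snd).to₂
  refine (Primrec.nat_rec₁ [[]] h2).of_eq fun s => ?_
  induction s with
  | zero => rfl
  | succ s ih => simp only [allStrings, ← ih]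

/-- Cylinders of equal length have equal measure, so comparing measures becomes counting strings,
which is primitive recursive for primitive recursive `P`. -/
theorem cantorMeasure_initSeg (P : List Bool → Prop) [DecidablePred P] (s : ℕ) :
    cantorMeasure.real {X | P (initSeg X s)} = ((allStrings s).filter P).length * (1 / 2) ^ s := by
  have h1 : {X | P (initSeg X s)} =
      ⋃ τ ∈ ((allStrings s).filter P).toFinset, {X | initSeg X s = τ} := by
    ext X
    simp [mem_allStrings, initSeg_length]
  rw [h1, measureReal_biUnion_finset]
  · rw [Finset.sum_congr rfl fun τ hτ => cantorMeasure_initSeg_eq (s := s) ?_]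
    · rw [Finset.sum_const, List.toFinset_card_of_nodup ((nodup_allStrings s).filter _)]
      simp
    · simp only [List.mem_toFinset, List.mem_filter, mem_allStrings] at hτ
      exact hτ.1
  · intro σ _ τ _ hne
    rw [Function.onFun, Set.disjoint_left]
    rintro X rfl h
    exact hne h
  · exact fun τ _ => measurableSet_initSeg_eq s τ

/-! ### Quantifier form and measurability of describing classes -/

open Classical in
/-- The finite information `τ` confirms, up to `j`, that its enumeration describes `f` correctly,
with at most the fraction `1 / (m + 1)` missing if `N ≤ j`. -/
def Confirms (V : List Bool → ℕ → Prop) (f : ℕ → ℕ) (m N j : ℕ) (τ : List Bool) : Prop :=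
  j ≤ τ.length ∧
    (N ≤ j → (m + 1) * ((List.range j).filter fun i => ¬ V τ (Nat.pair i (f i))).length ≤ j) ∧
    ∀ p < j, V τ p → p.unpair.2 = f p.unpair.1

/-- `m` and `N` express density `1`, while correctness is checked for every `j`, even below `N`. The
existential `l` waits for the enumerations that the density bound needs. -/
theorem mem_describingClass_iff {V : List Bool → ℕ → Prop} (hV : MonotoneRel V) (f : ℕ → ℕ)
    (X : ℕ → Bool) : X ∈ describingClass V f ↔
      ∀ m, ∃ N, ∀ j, ∃ l, Confirms V f m N j (initSeg X l) := by
  classical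
  have hcard : ∀ (j : ℕ) (P : ℕ → Prop) [DecidablePred P], ((Finset.range j).filter P).card =
      ((List.range j).filter fun i => P i).length := fun _ _ _ => rfl
  constructor
  · rintro ⟨hc, hd⟩ m
    obtain ⟨N, hN⟩ := hasAsymptoticDensity_one_iff.1 hd m
    refine ⟨N, fun j => ?_⟩
    have : ∀ i, ∃ l, Nat.pair i (f i) ∈ enumerated V X → V (initSeg X l) (Nat.pair i (f i)) := by
      intro i
      by_cases h : Nat.pair i (f i) ∈ enumerated V X
      · exact h.imp fun l hl _ => hl
      · exact ⟨0, fun h' => absurd h' h⟩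
    choose L hL using this
    -- By this length, every correct pair for an argument below `j` that is ever enumerated has
    -- appeared.
    refine ⟨j + ∑ i ∈ Finset.range j, L i, by simp [initSeg_length], fun hj => ?_, fun p _ hp =>
      hc p ⟨_, hp⟩⟩
    refine le_trans (Nat.mul_le_mul_left _ ?_) (hN j hj)
    rw [← hcard j fun i => ¬ V _ (Nat.pair i (f i))]
    refine Finset.card_le_card fun i hi => ?_
    rw [Finset.mem_filter] at hi ⊢
    refine ⟨hi.1, fun h => hi.2 (hV X (L i) _ _ ?_ (hL i h))⟩
    exact (Finset.single_le_sum (fun _ _ => Nat.zero_le _) hi.1).trans (Nat.le_add_left _ _)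
  · intro h
    refine ⟨fun p ⟨l, hl⟩ => ?_, hasAsymptoticDensity_one_iff.2 fun m => ?_⟩
    -- Taking `j = p + l + 1` puts `p` in the checked range, and the clause `j ≤ |τ|` forces a stage
    -- past `l`, where `p` is already enumerated.
    · obtain ⟨N, hN⟩ := h 0
      obtain ⟨l', h1, -, h3⟩ := hN (p + l + 1)
      rw [initSeg_length] at h1
      exact h3 p (by omega) (hV X l l' p (by omega) hl)
    · obtain ⟨N, hN⟩ := h m
      refine ⟨N, fun j hj => ?_⟩
      obtain ⟨l, -, h2, -⟩ := hN j
      refine le_trans (Nat.mul_le_mul_left _ ?_) (h2 hj)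
      rw [← hcard j fun i => ¬ V _ (Nat.pair i (f i))]
      refine Finset.card_le_card fun i hi => ?_
      rw [Finset.mem_filter] at hi ⊢
      exact ⟨hi.1, fun h => hi.2 ⟨l, h⟩⟩

theorem describingClass_eq {V : List Bool → ℕ → Prop} (hV : MonotoneRel V) (f : ℕ → ℕ) :
    describingClass V f = ⋂ m, ⋃ N, ⋂ j, ⋃ l, {X | Confirms V f m N j (initSeg X l)} := by
  ext X
  rw [mem_describingClass_iff hV]
  simp

theorem measurableSet_describingClass {V : List Bool → ℕ → Prop} (hV : MonotoneRel V)
    (f : ℕ → ℕ) : MeasurableSet (describingClass V f) := by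
  rw [describingClass_eq hV]
  exact .iInter fun m => .iUnion fun N => .iInter fun j => .iUnion fun l =>
    measurableSet_initSeg _ l

theorem measurableSet_mem_enumerated (V : List Bool → ℕ → Prop) (p : ℕ) :
    MeasurableSet {X | p ∈ enumerated V X} := by
  have : {X | p ∈ enumerated V X} = ⋃ l, {X | V (initSeg X l) p} := by
    ext X
    simp [enumerated]
  rw [this]
  exact .iUnion fun l => measurableSet_initSeg (fun τ => V τ p) l

/-! ### Clopen approximation and majority vote -/

theorem exists_initSeg_subset {U : Set (ℕ → Bool)} (hU : IsOpen U) {X : ℕ → Bool} (hX : X ∈ U) :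
    ∃ l, ∀ Y, initSeg Y l = initSeg X l → Y ∈ U := by
  obtain ⟨I, u, hu, hs⟩ := isOpen_pi_iff.1 hU X hX
  refine ⟨I.sup id + 1, fun Y hY => hs fun i hi => ?_⟩
  have : i ≤ I.sup id := Finset.le_sup (f := id) hi
  rw [(initSeg_eq_iff Y X _).1 hY i (by omega)]
  exact (hu i hi).2

theorem initSeg_take (X : ℕ → Bool) {l s : ℕ} (h : l ≤ s) :
    (initSeg X s).take l = initSeg X l := by
  rw [initSeg, ← List.map_take, List.take_range, min_eq_left h, initSeg]

/-- A class of positive measure fills at least three quarters of some class that is determined by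
initial segments of a fixed length. -/
theorem exists_initSeg_measure_diff_lt {S : Set (ℕ → Bool)} (hS : MeasurableSet S)
    (h0 : cantorMeasure S ≠ 0) : ∃ (l : ℕ) (P : List Bool → Prop),
      4 * cantorMeasure.real ({X | P (initSeg X l)} \ S) <
        cantorMeasure.real {X | P (initSeg X l)} := by
  have hpos : 0 < cantorMeasure.real S := by
    rw [measureReal_def]
    exact ENNReal.toReal_pos h0 (measure_ne_top _ _)
  -- With `μ(U \ S) < μ(S)/8` and `μ(K l) > μ(S)/2`, four times the excess stays below `μ(K l)`.
  obtain ⟨U, hSU, hU, hlt⟩ := S.exists_isOpen_lt_add (μ := cantorMeasure) (ε := ENNReal.ofReal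
    (cantorMeasure.real S / 8)) (measure_ne_top _ _) (by simpa using hpos)
  have hlt' : cantorMeasure.real U < cantorMeasure.real S + cantorMeasure.real S / 8 := by
    have := ENNReal.toReal_strict_mono (by finiteness) hlt
    rwa [ENNReal.toReal_add (by finiteness) (by finiteness),
      ENNReal.toReal_ofReal (by positivity)] at this
  -- `K l` is the union of the cylinders of length `l` inside `U`; these classes increase to `U`.
  set K : ℕ → Set (ℕ → Bool) := fun l => {X | ∀ Y, initSeg Y l = initSeg X l → Y ∈ U} with hK
  have hmono : Monotone K := by
    intro l l' h X hX Y hY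
    exact hX Y (by rw [← initSeg_take Y h, hY, initSeg_take X h])
  have hKU : ⋃ l, K l = U := by
    ext X
    simp only [Set.mem_iUnion]
    exact ⟨fun ⟨l, hl⟩ => hl X rfl, fun hX => exists_initSeg_subset hU hX⟩
  have hlim := tendsto_measure_iUnion_atTop (μ := cantorMeasure) hmono
  rw [hKU] at hlim
  have hlim' := (ENNReal.tendsto_toReal (measure_ne_top cantorMeasure U)).comp hlim
  have hSU' : cantorMeasure.real S ≤ cantorMeasure.real U := measureReal_mono hSU
  obtain ⟨l, hl⟩ := (hlim'.eventually (lt_mem_nhds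
    (show cantorMeasure.real S / 2 < cantorMeasure.real U by linarith))).exists
  refine ⟨l, fun τ => ∀ Y, initSeg Y l = τ → Y ∈ U, ?_⟩
  change 4 * cantorMeasure.real (K l \ S) < cantorMeasure.real (K l)
  have h1 : cantorMeasure.real (K l \ S) ≤ cantorMeasure.real (U \ S) :=
    measureReal_mono (Set.sdiff_subset_sdiff_left (hKU ▸ Set.subset_iUnion K l))
  have h2 : cantorMeasure.real (U \ S) = cantorMeasure.real U - cantorMeasure.real S :=
    measureReal_sdiff hSU hS
  have h3 : cantorMeasure.real S / 2 < cantorMeasure.real (K l) := hl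
  linarith

open Classical in
/-- More than half of the strings of length `s` that extend an element of `T` enumerate `p`. -/
def Majority (V : List Bool → ℕ → Prop) (l : ℕ) (T : List (List Bool)) (s p : ℕ) : Prop :=
  ((allStrings s).filter fun τ => τ.take l ∈ T).length <
    2 * ((allStrings s).filter fun τ => τ.take l ∈ T ∧ V τ p).length

theorem primrecRel_majority {V : List Bool → ℕ → Prop} (hV : PrimrecRel V) (l : ℕ)
    (T : List (List Bool)) : PrimrecRel (Majority V l T) := by
  classical
  have hT : PrimrecPred fun τ : List Bool => τ.take l ∈ T :=
    ((PrimrecRel.exists_mem_list Primrec.eq).comp (Primrec.const T)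
      (Primrec.list_take.comp (Primrec.const l) Primrec.id)).of_eq fun τ => by simp
  have h1 : PrimrecRel fun (τ : List Bool) (_ : ℕ) => τ.take l ∈ T := hT.comp Primrec.fst
  have h2 : PrimrecRel fun (τ : List Bool) (p : ℕ) => τ.take l ∈ T ∧ V τ p := h1.and hV
  have hA : Primrec fun a : ℕ × ℕ => allStrings a.1 := primrec_allStrings.comp Primrec.fst
  refine Primrec.nat_lt.comp (Primrec.list_length.comp (h1.listFilter.comp hA Primrec.snd))
    (Primrec.nat_mul.comp (Primrec.const 2)
      (Primrec.list_length.comp (h2.listFilter.comp hA Primrec.snd)))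

open Classical in
theorem majority_iff {V : List Bool → ℕ → Prop} {P : List Bool → Prop} {l s p : ℕ} (hs : l ≤ s) :
    Majority V l ((allStrings l).filter P) s p ↔
      cantorMeasure.real {X | P (initSeg X l)} <
        2 * cantorMeasure.real {X | P (initSeg X l) ∧ V (initSeg X s) p} := by
  have hT : ∀ X, (initSeg X s).take l ∈ (allStrings l).filter P ↔ P (initSeg X l) := by
    intro X
    rw [initSeg_take X hs, List.mem_filter, mem_allStrings]
    simp [initSeg_length]
  have h1 : {X | P (initSeg X l)} = {X | (initSeg X s).take l ∈ (allStrings l).filter P} := by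
    ext X; exact (hT X).symm
  have h2 : {X | P (initSeg X l) ∧ V (initSeg X s) p} =
      {X | (initSeg X s).take l ∈ (allStrings l).filter P ∧ V (initSeg X s) p} := by
    ext X; exact and_congr_left' (hT X).symm
  rw [h2, h1, cantorMeasure_initSeg (fun τ => τ.take l ∈ (allStrings l).filter P) s,
    cantorMeasure_initSeg (fun τ => τ.take l ∈ (allStrings l).filter P ∧ V τ p) s,
    ← mul_assoc, mul_lt_mul_iff_of_pos_right (by positivity), Majority]
  norm_cast

/-- A primitive recursive relation `R s (pair n v)` yields a partial computable function that
finds for `n` some `v` with `R s (pair n v)` for some `s`. -/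
theorem exists_partrec_search {R : ℕ → ℕ → Prop} (hR : PrimrecRel R) :
    ∃ d : ℕ →. ℕ, Nat.Partrec d ∧ (∀ n, ∀ v ∈ d n, ∃ s, R s (Nat.pair n v)) ∧
      ∀ n v s, R s (Nat.pair n v) → (d n).Dom := by
  classical
  have h : PrimrecRel fun n t : ℕ => R t.unpair.1 (Nat.pair n t.unpair.2) :=
    hR.comp (Primrec.fst.comp (Primrec.unpair.comp Primrec.snd))
      (Primrec₂.natPair.comp Primrec.fst (Primrec.snd.comp (Primrec.unpair.comp Primrec.snd)))
  refine ⟨fun n => (Nat.rfind fun t =>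
    Part.some (decide (R t.unpair.1 (Nat.pair n t.unpair.2)))).map fun t => t.unpair.2,
    Partrec.nat_iff.1 (Partrec.map (Partrec.rfind h.decide.to_comp) ?_), ?_, ?_⟩
  · exact (Computable.snd.comp (Computable.unpair.comp Computable.snd)).to₂
  · intro n v hv
    obtain ⟨t, ht, rfl⟩ := (Part.mem_map_iff _).1 hv
    have := (Nat.mem_rfind.1 ht).1
    simp only [Part.mem_some_iff, eq_comm (a := true), decide_eq_true_eq] at this
    exact ⟨_, this⟩
  · intro n v s hs
    change (Nat.rfind _).Dom
    obtain ⟨t, ht, -⟩ := Nat.rfind_min'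
      (p := fun t => decide (R t.unpair.1 (Nat.pair n t.unpair.2))) (m := Nat.pair s v)
      (by simpa using hs)
    exact Part.dom_iff_mem.2 ⟨t, ht⟩

/-- If the class of all `X` that describe `f` has positive measure, then `f` is generically
computable by majority vote. -/
theorem cantorMeasure_describingClass {V : List Bool → ℕ → Prop} (hV : PrimrecRel V)
    (hm : MonotoneRel V) {f : ℕ → ℕ} (hf : ¬ GenericallyComputable f) :
    cantorMeasure (describingClass V f) = 0 := by
  classical
  by_contra h0
  have hS := measurableSet_describingClass hm f
  obtain ⟨l, P, hlt⟩ := exists_initSeg_measure_diff_lt hS h0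
  set S := describingClass V f with hSdef
  set K : Set (ℕ → Bool) := {X | P (initSeg X l)} with hK
  have hKm : MeasurableSet K := measurableSet_initSeg P l
  have hKS : 0 ≤ cantorMeasure.real (K \ S) := measureReal_nonneg
  have hKpos : 0 < cantorMeasure.real K := by linarith
  -- The vote is held only among strings of length at least `l`, where membership in `K` is decided.
  obtain ⟨d, pd, hd1, hd2⟩ := exists_partrec_search
    (R := fun s p => l ≤ s ∧ Majority V l ((allStrings l).filter P) s p)
    (PrimrecPred.and (Primrec.nat_le.comp (Primrec.const l) Primrec.fst)
      (primrecRel_majority hV l _))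
  refine hf ⟨d, pd, fun n v hv => ?_, ?_⟩
  · obtain ⟨s, hs, hmaj⟩ := hd1 n v hv
    rw [majority_iff hs] at hmaj
    by_contra hne
    -- No element of `S` enumerates a wrong pair, so a wrong majority would need more than half of
    -- `K` inside `K \ S`.
    have hsub : {X | P (initSeg X l) ∧ V (initSeg X s) (Nat.pair n v)} ⊆ K \ S := by
      rintro X ⟨h1, h2⟩
      refine ⟨h1, fun hX => hne ?_⟩
      simpa using hX.1 _ ⟨s, h2⟩
    have := measureReal_mono (μ := cantorMeasure) hsub
    linarith
  · set E : ℕ → Set (ℕ → Bool) := fun n => {X | Nat.pair n (f n) ∈ enumerated V X} with hE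
    have hEm : ∀ n, MeasurableSet (E n) := fun n => measurableSet_mem_enumerated V _
    rw [hasAsymptoticDensity_compl]
    refine (hasAsymptoticDensity_zero_of_forall cantorMeasure (H := fun n => (S ∩ K) \ E n)
      (fun n => (hS.inter hKm).diff (hEm n)) (fun X => ?_)
      (show 0 < cantorMeasure.real K / 4 by positivity)).mono_zero fun n hn => ?_
    · by_cases hX : X ∈ S ∩ K
      · refine (hasAsymptoticDensity_compl.1 hX.1.2).mono_zero fun n hn => hn.2
      · have : {n | X ∈ (S ∩ K) \ E n} = ∅ := by
          ext n
          simp only [Set.mem_ofPred_eq, Set.mem_empty_iff_false, iff_false]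
          exact fun h => hX h.1
        rw [this]
        exact hasAsymptoticDensity_empty
    -- If more than half of `K` enumerated `(n, f n)`, continuity from below would give a finite
    -- stage with a majority, and `d n` would be defined.
    · have hhalf : 2 * cantorMeasure.real (K ∩ E n) ≤ cantorMeasure.real K := by
        have hU : K ∩ E n = ⋃ s,
            {X | P (initSeg X l) ∧ V (initSeg X (l + s)) (Nat.pair n (f n))} := by
          ext X
          simp only [Set.mem_iUnion]
          constructor
          · rintro ⟨h1, s, h2⟩
            exact ⟨s, h1, hm X s (l + s) _ (by omega) h2⟩
          · rintro ⟨s, h1, h2⟩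
            exact ⟨h1, _, h2⟩
        have hmono : Monotone fun s =>
            {X | P (initSeg X l) ∧ V (initSeg X (l + s)) (Nat.pair n (f n))} :=
          fun s s' h X hX => ⟨hX.1, hm X _ _ _ (by omega) hX.2⟩
        have hlim := (ENNReal.tendsto_toReal (measure_ne_top cantorMeasure _)).comp
          (tendsto_measure_iUnion_atTop (μ := cantorMeasure) hmono)
        rw [← hU] at hlim
        have hle : cantorMeasure.real (K ∩ E n) ≤ cantorMeasure.real K / 2 := by
          refine le_of_tendsto' hlim fun s => ?_
          by_contra hcon
          refine hn (hd2 n (f n) (l + s) ⟨by omega, (majority_iff (by omega)).2 ?_⟩)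
          have : cantorMeasure.real K / 2 < cantorMeasure.real
            {X | P (initSeg X l) ∧ V (initSeg X (l + s)) (Nat.pair n (f n))} := not_le.1 hcon
          linarith
        linarith
      -- Of `K`, at most a half lies in `E n` and less than a quarter outside `S`; at least a
      -- quarter is left for `(S ∩ K) \ E n`.
      have hcover : K ⊆ ((S ∩ K) \ E n ∪ K ∩ E n) ∪ K \ S := by
        intro X hX
        by_cases h1 : X ∈ S
        · by_cases h2 : X ∈ E n
          · exact Or.inl (Or.inr ⟨hX, h2⟩)
          · exact Or.inl (Or.inl ⟨⟨h1, hX⟩, h2⟩)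
        · exact Or.inr ⟨hX, h1⟩
      have h1 := measureReal_mono (μ := cantorMeasure) hcover
      have h2 := measureReal_union_le (μ := cantorMeasure) ((S ∩ K) \ E n ∪ K ∩ E n) (K \ S)
      have h3 := measureReal_union_le (μ := cantorMeasure) ((S ∩ K) \ E n) (K ∩ E n)
      change cantorMeasure.real K / 4 ≤ cantorMeasure.real ((S ∩ K) \ E n)
      linarith

/-! ### Arithmetical complexity relative to `f` -/

/-- The table of the first `j` values of `f` is computable from `f`. -/
theorem recursiveIn_encode_map_range (f : ℕ → ℕ) : Nat.RecursiveIn (oracleOf f)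
    (fun j => Part.some (Encodable.encode ((List.range j).map f))) := by
  have happ : Nat.RecursiveIn (oracleOf f) fun m => Part.some (Encodable.encode
      (Denumerable.ofNat (List ℕ) m.unpair.1 ++ [m.unpair.2])) := by
    refine Nat.Primrec.recursiveIn (Primrec.nat_iff.1 (Primrec.encode.comp
      (Primrec.list_concat.comp ((Primrec.ofNat (List ℕ)).comp
        (Primrec.fst.comp Primrec.unpair)) (Primrec.snd.comp Primrec.unpair))))
  have hstep := happ.comp ((Nat.RecursiveIn.right.comp Nat.RecursiveIn.right).pair
    ((Nat.RecursiveIn.oracle (O := oracleOf f) (f : ℕ →. ℕ) rfl).comp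
      (Nat.RecursiveIn.left.comp Nat.RecursiveIn.right)))
  have hbase : Nat.RecursiveIn (oracleOf f) fun _ => Part.some (Encodable.encode ([] : List ℕ)) :=
    Nat.Primrec.recursiveIn (Primrec.nat_iff.1 (Primrec.const _))
  have hpair : Nat.RecursiveIn (oracleOf f) fun j => Part.some (Nat.pair 0 j) :=
    Nat.Primrec.recursiveIn (Primrec.nat_iff.1
      (Primrec₂.natPair.comp (Primrec.const 0) Primrec.id))
  refine ((Nat.RecursiveIn.prec hbase hstep).comp hpair).of_eq fun j => ?_
  simp only [Part.bind_eq_bind, Part.bind_some, Nat.unpair_pair]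
  induction j with
  | zero => rfl
  | succ j ih =>
    dsimp only
    rw [ih]
    simp only [Seq.seq, Part.coe_some, Part.bind_some, Nat.unpair_pair, Part.map_eq_map,
      Part.map_some, List.range_succ, List.map_append, List.map_cons,
      List.map_nil]
    change (((Part.some j).bind fun y => Part.some (f y)).map _).bind _ = _
    simp

/-- The oracle is used only to build a finite table of `f`; a primitive recursive test of the table
then halts or diverges. -/
theorem ceIn_of_primrecPred_table {α : Type} [Primcodable α] {Q : α × List ℕ → Prop}
    (hQ : PrimrecPred Q) {j : α → ℕ} (hj : Primrec j) (f : ℕ → ℕ) :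
    CEIn f {a | Q (a, (List.range (j a)).map f)} := by
  classical
  have hψ : Partrec fun b : α × List ℕ => Nat.rfind fun _ => Part.some (decide (Q b)) :=
    Partrec.rfind (hQ.decide.to_comp.comp Computable.fst).partrec.to₂
  refine ⟨fun a => Nat.rfind fun _ => Part.some (decide (Q (a, (List.range (j a)).map f))),
    ?_, fun a => ?_⟩
  -- The default `0` is harmless: on numbers that do not decode, the final test diverges anyway.
  · have hJ : Nat.RecursiveIn (oracleOf f) fun n => Part.some
        (((Encodable.decode n : Option α).map j).getD 0) :=
      Nat.Primrec.recursiveIn (Primrec.nat_iff.1 (Primrec.option_getD.comp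
        (Primrec.option_map Primrec.decode (hj.comp Primrec.snd).to₂) (Primrec.const 0)))
    have hid : Nat.RecursiveIn (oracleOf f) fun n => Part.some n :=
      Nat.Primrec.recursiveIn (Primrec.nat_iff.1 Primrec.id)
    refine (Nat.RecursiveIn.comp (Nat.Partrec.recursiveIn hψ)
      (hid.pair ((recursiveIn_encode_map_range f).comp hJ))).of_eq fun n => ?_
    cases h : (Encodable.decode n : Option α) <;> simp [Seq.seq, h]
  · rw [Part.dom_iff_mem]
    constructor
    · intro ha
      exact ⟨0, Nat.mem_rfind.2 (by simpa using ha)⟩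
    · rintro ⟨y, hy⟩
      have := (Nat.mem_rfind.1 hy).1
      simpa using this

open Classical in
/-- `Confirms`, with the values of `f` below `j = F.length` given by the table `F`. -/
def TableConfirms (V : List Bool → ℕ → Prop) (F : List ℕ) (m N : ℕ) (τ : List Bool) : Prop :=
  F.length ≤ τ.length ∧
    (¬ N ≤ F.length ∨ (m + 1) * ((List.range F.length).filter
      fun i => ¬ V τ (Nat.pair i (F.getD i 0))).length ≤ F.length) ∧
    ∀ p ∈ List.range F.length, ¬ V τ p ∨ p.unpair.2 = F.getD p.unpair.1 0

theorem tableConfirms_map_range {V : List Bool → ℕ → Prop} {f : ℕ → ℕ} {m N j : ℕ}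
    {τ : List Bool} :
    TableConfirms V ((List.range j).map f) m N τ ↔ Confirms V f m N j τ := by
  classical
  have hget : ∀ i < j, ((List.range j).map f).getD i 0 = f i := by
    intro i hi
    simp [List.getD_eq_getElem?_getD, hi]
  simp only [TableConfirms, Confirms, List.length_map, List.length_range, List.mem_range,
    ← imp_iff_not_or]
  refine and_congr_right' (and_congr ?_ ?_)
  · rw [List.filter_congr (q := fun i => decide (¬ V τ (Nat.pair i (f i))))]
    intro i hi
    rw [hget i (by simpa using hi)]
  · refine forall₂_congr fun p hp => ?_
    -- The first component of `p` is at most `p < j`, so the table covers it.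
    rw [hget _ ((Nat.unpair_left_le p).trans_lt hp)]

theorem primrecPred_tableConfirms {V : List Bool → ℕ → Prop} (hV : PrimrecRel V) :
    PrimrecPred fun b : (ℕ × List Bool) × List ℕ =>
      TableConfirms V b.2 b.1.1.unpair.1.unpair.1.unpair.2 b.1.1.unpair.1.unpair.2 b.1.2 := by
  classical
  have hF : Primrec fun b : (ℕ × List Bool) × List ℕ => b.2 := Primrec.snd
  have hτ : Primrec fun b : (ℕ × List Bool) × List ℕ => b.1.2 := Primrec.snd.comp Primrec.fst
  have hc : Primrec fun b : (ℕ × List Bool) × List ℕ => b.1.1.unpair.1 :=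
    Primrec.fst.comp (Primrec.unpair.comp (Primrec.fst.comp Primrec.fst))
  have hN : Primrec fun b : (ℕ × List Bool) × List ℕ => b.1.1.unpair.1.unpair.2 :=
    Primrec.snd.comp (Primrec.unpair.comp hc)
  have hm : Primrec fun b : (ℕ × List Bool) × List ℕ => b.1.1.unpair.1.unpair.1.unpair.2 :=
    Primrec.snd.comp (Primrec.unpair.comp (Primrec.fst.comp (Primrec.unpair.comp hc)))
  have hL : Primrec fun b : (ℕ × List Bool) × List ℕ => b.2.length := Primrec.list_length.comp hF
  have h1 : PrimrecRel fun (i : ℕ) (b : (ℕ × List Bool) × List ℕ) =>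
      ¬ V b.1.2 (Nat.pair i (b.2.getD i 0)) :=
    PrimrecPred.not (hV.comp (hτ.comp Primrec.snd) (Primrec₂.natPair.comp Primrec.fst
      ((Primrec.list_getD 0).comp (hF.comp Primrec.snd) Primrec.fst)))
  have h2 : PrimrecRel fun (p : ℕ) (b : (ℕ × List Bool) × List ℕ) =>
      ¬ V b.1.2 p ∨ p.unpair.2 = b.2.getD p.unpair.1 0 :=
    (PrimrecPred.not (hV.comp (hτ.comp Primrec.snd) Primrec.fst)).or
      (Primrec.eq.comp (Primrec.snd.comp (Primrec.unpair.comp Primrec.fst))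
        ((Primrec.list_getD 0).comp (hF.comp Primrec.snd)
          (Primrec.fst.comp (Primrec.unpair.comp Primrec.fst))))
  have hR := Primrec.list_range.comp hL
  refine (Primrec.nat_le.comp hL (Primrec.list_length.comp hτ)).and
    (((Primrec.nat_le.comp hN hL).not.or (Primrec.nat_le.comp (Primrec.nat_mul.comp
      (Primrec.succ.comp hm) (Primrec.list_length.comp (h1.listFilter.comp hR Primrec.id))) hL)).and
      (h2.forall_mem_list.comp hR Primrec.id))

/-- De Morgan's laws turn `⋂ m, ⋃ N, ⋂ j, ⋃ l` into the alternating unions of complements required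
by `UniformlySigma`. Indices are nested as `⟨⟨⟨k, m⟩, N⟩, j⟩`, with `k` a dummy for the constant
sequence. -/
theorem isSigmaClass_compl_describingClass {V : List Bool → ℕ → Prop} (hV : PrimrecRel V)
    (hm : MonotoneRel V) (f : ℕ → ℕ) : IsSigmaClass 4 f (describingClass V f)ᶜ := by
  set U : Set (ℕ × List Bool) := {a | TableConfirms V ((List.range a.1.unpair.2).map f)
    a.1.unpair.1.unpair.1.unpair.2 a.1.unpair.1.unpair.2 a.2} with hU
  have hUce : CEIn f U := ceIn_of_primrecPred_table (primrecPred_tableConfirms hV)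
    (Primrec.snd.comp (Primrec.unpair.comp Primrec.fst)) f
  set D₁ : ℕ → Set (ℕ → Bool) := fun c => {X | ∃ l : ℕ, (c, (List.range l).map X) ∈ U} with hD₁
  refine ⟨fun a => ⋃ N, (⋃ j, (D₁ (Nat.pair (Nat.pair a N) j))ᶜ)ᶜ,
    ⟨fun b => ⋃ j, (D₁ (Nat.pair b j))ᶜ, ⟨D₁, ⟨U, hUce, fun _ => rfl⟩, fun _ => rfl⟩,
      fun _ => rfl⟩, fun k => ?_⟩
  have hD : ∀ m N j, D₁ (Nat.pair (Nat.pair (Nat.pair k m) N) j) =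
      ⋃ l, {X | Confirms V f m N j (initSeg X l)} := by
    intro m N j
    ext X
    simp only [hD₁, hU, Set.mem_ofPred_eq, Nat.unpair_pair, tableConfirms_map_range,
      Set.mem_iUnion]
    rfl
  rw [describingClass_eq hm]
  simp only [hD, Set.compl_iInter, Set.compl_iUnion, compl_compl]

theorem not_weaklyRandomRel_of_mem_describingClass {V : List Bool → ℕ → Prop} (hV : PrimrecRel V)
    (hm : MonotoneRel V) {f : ℕ → ℕ} (hf : ¬ GenericallyComputable f) {X : ℕ → Bool}
    (hX : X ∈ describingClass V f) : ¬ WeaklyRandomRel 4 f X := fun h =>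
  h _ (isSigmaClass_compl_describingClass hV hm f)
    ((prob_compl_eq_one_iff (measurableSet_describingClass hm f)).2
      (cantorMeasure_describingClass hV hm hf)) hX

/-! ### Conclusion -/

theorem cantorMeasure_iUnion_describingClass {f : ℕ → ℕ} (hf : ¬ GenericallyComputable f) :
    cantorMeasure (⋃ c, describingClass (stageRel c) f) = 0 :=
  measure_iUnion_null fun c =>
    cantorMeasure_describingClass (primrecRel_stageRel c) (monotoneRel_stageRel c) hf

theorem mainTheorem3 :
    (∀ f : ℕ → ℕ, ¬ GenericallyComputable f →
      cantorMeasure {X : ℕ → Bool | GenericallyComputableRel f X} = 0 ∧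
      ∀ X : ℕ → Bool, GenericallyComputableRel f X → ¬ WeaklyRandomRel 4 f X) ∧
    (∀ A : ℕ → Bool, uniformGenericUpperCone A ≠ Set.univ →
      cantorMeasure (uniformGenericUpperCone A) = 0) ∧
    (∀ A : ℕ → Bool, nonuniformGenericUpperCone A ≠ Set.univ →
      cantorMeasure (nonuniformGenericUpperCone A) = 0) := by
  refine ⟨fun f hf => ⟨?_, fun X hX => ?_⟩, fun A hA => ?_, fun A hA => ?_⟩
  · exact measure_mono_null (genericallyComputableRel_subset f)
      (cantorMeasure_iUnion_describingClass hf)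
  · obtain ⟨c, hc⟩ := Set.mem_iUnion.1 (genericallyComputableRel_subset f hX)
    exact not_weaklyRandomRel_of_mem_describingClass (primrecRel_stageRel c)
      (monotoneRel_stageRel c) hf hc
  · have hf : ¬ GenericallyComputable (charFun01 A) := fun h =>
      hA (uniformGenericUpperCone_eq_univ h)
    exact measure_mono_null ((uniformGenericUpperCone_subset A).trans
      (nonuniformGenericUpperCone_subset A)) (cantorMeasure_iUnion_describingClass hf)
  · have hf : ¬ GenericallyComputable (charFun01 A) := fun h =>
      hA (Set.univ_subset_iff.1
        ((uniformGenericUpperCone_eq_univ h).symm.subset.trans (uniformGenericUpperCone_subset A)))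
    exact measure_mono_null (nonuniformGenericUpperCone_subset A)
      (cantorMeasure_iUnion_describingClass hf)
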